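/- A function $f:\{-1,1\}^n\to\{-1,1\}$ is a $k$-junta if it depends only on at most $k$ of its $n$ input variables. Consider quantum algorithms that may adaptively perform arbitrary quantum operations and measurements on a finite-dimensional memory and have access to an unknown $f$ through two oracles: the classical membership oracle $\mathsf{MQ}(f)$, which on a classical query $x\in\{-1,1\}^n$ returns $f(x)$, and the quantum membership oracle $\mathsf{QMQ}(f)$, which acts on computational basis states by $|x,b\rangle\mapsto|x,b\cdot f(x)\rangle$ for $x\in\{-1,1\}^n$, $b\in\{-1,1\}$. Such an algorithm is a $1/10$-learning algorithm for $k$-juntas over $\{-1,1\}^n$ if for every $k$-junta $f$ it outputs, with probability at least $2/3$, a hypothesis $h:\{-1,1\}^n\to\{-1,1\}$ that agrees with $f$ on at least a $1-\frac1{10}$ fraction of the inputs in $\{-1,1\}^n$. Queries are counted in the worst case. There is an absolute constant $c>0$ such that for all integers $0\le k\le n$, every $1/10$-learning algorithm for $k$-juntas over $\{-1,1\}^n$ that uses at most $\frac{1}{101}2^k$ classical $\mathsf{MQ}$ queries must use at least $c\,2^k$ $\mathsf{QMQ}$ queries (that is, $\Omega(2^k)$ quantum queries in addition to the classical ones). 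-/

import Mathlib

open scoped Matrix

namespace JuntaLearning

/-- The Boolean cube `{-1,1}^n`; the two signs are the units of `ℤ`. -/
abbrev Cube (n : ℕ) : Type := Fin n → ℤˣ

/-- Boolean functions `{-1,1}^n → {-1,1}`. -/
abbrev BoolFn (n : ℕ) : Type := Cube n → ℤˣ

/-- `f` is a `k`-junta: it depends only on (at most) `k` of its `n` input variables. -/
def IsJunta {n : ℕ} (k : ℕ) (f : BoolFn n) : Prop :=
  ∃ S : Finset (Fin n), S.card ≤ k ∧ DependsOn f (S : Set (Fin n))

/-- `h` agrees with `f` on at least a `1 - ε` fraction of the inputs in `{-1,1}^n`. -/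
def IsAccurate {n : ℕ} (ε : ℝ) (f h : BoolFn n) : Prop :=
  1 - ε ≤ ((Finset.univ.filter fun x : Cube n => h x = f x).card : ℝ) / 2 ^ n

/-- Labels `(x, b, w)` of the computational basis states `|x, b, w⟩`: a query register
`x ∈ {-1,1}^n`, an answer register `b ∈ {-1,1}` and a `d`-dimensional workspace. -/
abbrev BasisLabel (n d : ℕ) : Type := Cube n × ℤˣ × Fin d

/-- (Not necessarily normalized) state vectors, as families of amplitudes. -/
abbrev StateVec (n d : ℕ) : Type := BasisLabel n d → ℂ

/-- The squared Euclidean norm of a state vector. -/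
noncomputable def normSq {n d : ℕ} (ψ : StateVec n d) : ℝ := ∑ z, ‖ψ z‖ ^ 2

/-- The quantum membership oracle `QMQ(f)`, i.e. the linear map which sends the basis state
`|x, b, w⟩` to `|x, b * f x, w⟩` (see `qmqOracle_single`). -/
def qmqOracle {n d : ℕ} (f : BoolFn n) (ψ : StateVec n d) : StateVec n d :=
  fun z => ψ (z.1, z.2.1 * f z.1, z.2.2)

theorem qmqOracle_single {n d : ℕ} (f : BoolFn n) (x : Cube n) (b : ℤˣ) (w : Fin d) :
    qmqOracle f (Pi.single (x, b, w) 1) = Pi.single (x, b * f x, w) 1 := by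
  funext ⟨y, c, v⟩
  have h : ((y, c * f y, v) = (x, b, w)) ↔ ((y, c, v) = (x, b * f x, w)) := by
    simp only [Prod.mk.injEq]
    constructor
    · rintro ⟨rfl, rfl, rfl⟩
      simp [mul_assoc, Int.units_mul_self]
    · rintro ⟨rfl, rfl, rfl⟩
      simp [mul_assoc, Int.units_mul_self]
  simp only [qmqOracle, Pi.single_apply, h]

/-- Adaptive programs with access to a classical and a quantum membership oracle, acting on a
quantum memory spanned by the states `|x, b, w⟩`, with classical control.

* `halt h`: stop and output the hypothesis `h`.
* `instr m K hK next`: perform the quantum operation with `m` classical outcomes and Kraus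
  operators `K i` (a unitary if `m = 1`; projective measurements and coin tosses are special
  cases), and go on with `next i` if the outcome is `i`.
* `qmq next`: one query to `QMQ(f)`, then go on with `next`.
* `mq x next`: one query to `MQ(f)` on the classical input `x`, then go on with `next (f x)`. -/
inductive Program (n d : ℕ) : Type
  | halt (h : BoolFn n) : Program n d
  | instr (m : ℕ) (K : Fin m → Matrix (BasisLabel n d) (BasisLabel n d) ℂ)
      (hK : ∑ i, (K i)ᴴ * K i = 1) (next : Fin m → Program n d) : Program n d
  | qmq (next : Program n d) : Program n d
  | mq (x : Cube n) (next : ℤˣ → Program n d) : Program n d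

namespace Program

variable {n d : ℕ}

/-- Number of classical membership queries in the worst case, i.e. on any branch. -/
def mqCount : Program n d → ℕ
  | halt _ => 0
  | instr _ _ _ next => Finset.univ.sup fun i => (next i).mqCount
  | qmq next => next.mqCount
  | mq _ next => 1 + Finset.univ.sup fun b => (next b).mqCount

/-- Number of quantum membership queries in the worst case, i.e. on any branch. -/
def qmqCount : Program n d → ℕ
  | halt _ => 0
  | instr _ _ _ next => Finset.univ.sup fun i => (next i).qmqCount
  | qmq next => 1 + next.qmqCount
  | mq _ next => Finset.univ.sup fun b => (next b).qmqCount

/-- `outputProb f h P ψ` is the probability that `P`, run with oracles for `f` on the memory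
state `ψ`, outputs `h`. After a measurement the state is not renormalized: the squared norm of
the state is the probability of the branch, starting from a unit vector (Born rule). -/
noncomputable def outputProb (f h : BoolFn n) : Program n d → StateVec n d → ℝ
  | halt h', ψ => if h' = h then normSq ψ else 0
  | instr _ K _ next, ψ => ∑ i, (next i).outputProb f h (K i *ᵥ ψ)
  | qmq next, ψ => next.outputProb f h (qmqOracle f ψ)
  | mq x next, ψ => (next (f x)).outputProb f h ψ

end Program

/-- A quantum algorithm for functions on `{-1,1}^n` with access to `MQ` and `QMQ`: the dimension
of its workspace, the initial state of its memory (a unit vector), and its program. -/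
structure Algorithm (n : ℕ) where
  workDim : ℕ
  init : StateVec n workDim
  init_unit : normSq init = 1
  program : Program n workDim

namespace Algorithm

variable {n : ℕ}

/-- Worst-case number of classical membership queries. -/
def mqCount (A : Algorithm n) : ℕ := A.program.mqCount

/-- Worst-case number of quantum membership queries. -/
def qmqCount (A : Algorithm n) : ℕ := A.program.qmqCount

/-- Probability that the algorithm outputs the hypothesis `h` when the target is `f`. -/
noncomputable def outputProb (A : Algorithm n) (f h : BoolFn n) : ℝ :=
  A.program.outputProb f h A.init

open scoped Classical in
/-- `A` is an `ε`-learning algorithm for the class `C` under the uniform distribution: for every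
target `f ∈ C` it outputs, with probability at least `2/3`, a hypothesis which agrees with `f` on
at least a `1 - ε` fraction of the inputs. -/
def IsLearner (A : Algorithm n) (ε : ℝ) (C : Set (BoolFn n)) : Prop :=
  ∀ f ∈ C, (2 / 3 : ℝ) ≤
    ∑ h ∈ Finset.univ.filter (fun h : BoolFn n => IsAccurate ε f h), A.outputProb f h

end Algorithm

end JuntaLearning

/-! Polynomial method plus counting. Restrict to targets that apply some `g` to the first `k`
variables; put `N = 2 ^ k`. A quantum query raises the degree of the amplitudes in the `N` signs of
`g` by at most one, hence that of an output probability by two. A classical query only selects the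
next branch, which costs one. So `g ↦ Pr[output h]` has degree at most `D = 2 * qmqCount + mqCount`
(`outputProb_mem_lowDegree`).

A nonnegative polynomial of degree at most `D` is nowhere more than `C` times its mean, `C` being
the number of monomials (`le_mean_of_mem_lowDegree`). If each `h` is accurate for at most `B` of the
`g`, then summing the success probabilities over all `g` gives `2/3 * 2 ^ N ≤ B * C`
(`success_le_mul`). Chernoff-type bounds give `B ≤ (25/18) ^ N` and, when `50 * D ≤ N`, `C ≤ (55/49)
^ N`. The product of the bases is below 2, a contradiction once `N ≥ 2`; `N = 1` needs the sharper
`B = 1`. -/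

namespace JuntaLearning

/-! ### Fourier analysis on the cube and two tail bounds. -/

section LowDegree

variable {Y : Type*}

/-- The value of a sign as a complex number. -/
def sgn (b : ℤˣ) : ℂ := ((b : ℤ) : ℂ)

@[simp] theorem sgn_one : sgn 1 = 1 := by simp [sgn]

@[simp] theorem sgn_neg_one : sgn (-1) = -1 := by simp [sgn]

theorem sgn_mul_self (b : ℤˣ) : sgn b * sgn b = 1 := by
  rcases Int.units_eq_one_or b with rfl | rfl <;> simp

theorem norm_sgn (b : ℤˣ) : ‖sgn b‖ = 1 := by
  rcases Int.units_eq_one_or b with rfl | rfl <;> simp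

theorem star_sgn (b : ℤˣ) : star (sgn b) = sgn b := by
  rcases Int.units_eq_one_or b with rfl | rfl <;> simp

/-- The Fourier character of the cube `Y → {-1,1}` indexed by `S`. -/
def character (S : Finset Y) : (Y → ℤˣ) → ℂ := fun g => ∏ y ∈ S, sgn (g y)

theorem norm_character (S : Finset Y) (g : Y → ℤˣ) : ‖character S g‖ = 1 := by
  simp [character, norm_prod, norm_sgn]

/-- Functions on the cube `Y → {-1,1}` which are polynomials of degree at most `D`. -/
def lowDegree (Y : Type*) (D : ℕ) : Submodule ℂ ((Y → ℤˣ) → ℂ) :=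
  Submodule.span ℂ (character '' {S : Finset Y | S.card ≤ D})

theorem lowDegree_mono {D E : ℕ} (h : D ≤ E) : lowDegree Y D ≤ lowDegree Y E :=
  Submodule.span_mono (Set.image_mono fun _ hS => le_trans hS h)

theorem const_mem_lowDegree (c : ℂ) (D : ℕ) : (fun _ => c) ∈ lowDegree Y D := by
  have h : (fun _ => c) = c • character (∅ : Finset Y) := by
    funext g
    simp [character]
  rw [h]
  exact Submodule.smul_mem _ _ (Submodule.subset_span ⟨∅, by simp, rfl⟩)

theorem sgn_mem_lowDegree (y : Y) : (fun g : Y → ℤˣ => sgn (g y)) ∈ lowDegree Y 1 :=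
  Submodule.subset_span ⟨{y}, by simp, by funext g; simp [character]⟩

theorem star_mem_lowDegree {D : ℕ} {p : (Y → ℤˣ) → ℂ} (hp : p ∈ lowDegree Y D) :
    star p ∈ lowDegree Y D := by
  induction hp using Submodule.span_induction with
  | mem p hp =>
    obtain ⟨S, hS, rfl⟩ := hp
    refine Submodule.subset_span ⟨S, hS, ?_⟩
    funext g
    simp only [Pi.star_apply, character, star_prod, star_sgn]
  | zero => simp
  | add p q _ _ hp hq => rw [star_add]; exact Submodule.add_mem _ hp hq
  | smul c p _ hp => rw [star_smul]; exact Submodule.smul_mem _ _ hp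

variable [Fintype Y] [DecidableEq Y]

theorem character_mul (S T : Finset Y) :
    character S * character T = character (symmDiff S T) := by
  funext g
  have h : ∀ S : Finset Y, character S g = ∏ y, if y ∈ S then sgn (g y) else 1 := by
    intro S
    simp [character, Finset.prod_ite_mem]
  simp only [Pi.mul_apply, h, ← Finset.prod_mul_distrib]
  refine Finset.prod_congr rfl fun y _ => ?_
  by_cases hS : y ∈ S <;> by_cases hT : y ∈ T <;>
    simp [Finset.mem_symmDiff, hS, hT, sgn_mul_self]

theorem sum_character (S : Finset Y) :
    ∑ g, character S g = if S = ∅ then (2 : ℂ) ^ Fintype.card Y else 0 := by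
  have h : ∀ g : Y → ℤˣ, character S g = ∏ y, if y ∈ S then sgn (g y) else 1 := by
    intro g
    simp [character, Finset.prod_ite_mem]
  simp only [h]
  rw [← Fintype.prod_sum (fun y (b : ℤˣ) => if y ∈ S then sgn b else 1)]
  split_ifs with hS
  · subst hS
    simp
  · obtain ⟨y, hy⟩ := Finset.nonempty_iff_ne_empty.mpr hS
    refine Finset.prod_eq_zero (Finset.mem_univ y) ?_
    simp [hy]

theorem mul_mem_lowDegree {D E : ℕ} {p q : (Y → ℤˣ) → ℂ} (hp : p ∈ lowDegree Y D)
    (hq : q ∈ lowDegree Y E) : p * q ∈ lowDegree Y (D + E) := by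
  have h := Submodule.mul_mem_mul hp hq
  rw [lowDegree, lowDegree, Submodule.span_mul_span] at h
  refine Submodule.span_mono ?_ h
  rintro _ ⟨_, ⟨S, hS, rfl⟩, _, ⟨T, hT, rfl⟩, rfl⟩
  refine ⟨symmDiff S T, ?_, (character_mul S T).symm⟩
  have h1 : (symmDiff S T).card ≤ (S ∪ T).card :=
    Finset.card_le_card (by
      intro y hy
      rw [Finset.mem_symmDiff] at hy
      rw [Finset.mem_union]
      tauto)
  exact h1.trans ((Finset.card_union_le S T).trans (add_le_add hS hT))

/-- Case distinction on a single variable raises the degree by at most one. -/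
theorem select_mem_lowDegree {D : ℕ} (y : Y) {p : ℤˣ → (Y → ℤˣ) → ℂ}
    (hp : ∀ b, p b ∈ lowDegree Y D) : (fun g => p (g y) g) ∈ lowDegree Y (D + 1) := by
  have h : (fun g => p (g y) g) = (1 / 2 : ℂ) • (p 1 + p (-1)) +
      (1 / 2 : ℂ) • ((p 1 - p (-1)) * fun g => sgn (g y)) := by
    funext g
    rcases Int.units_eq_one_or (g y) with h | h <;> simp [h] <;> ring
  rw [h]
  refine Submodule.add_mem _ (Submodule.smul_mem _ _ ?_) (Submodule.smul_mem _ _ ?_)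
  · exact lowDegree_mono (Nat.le_succ D) (Submodule.add_mem _ (hp 1) (hp (-1)))
  · exact mul_mem_lowDegree (Submodule.sub_mem _ (hp 1) (hp (-1))) (sgn_mem_lowDegree y)

/-- The number of monomials of degree at most `D`. -/
def monomialCount (Y : Type*) [Fintype Y] [DecidableEq Y] (D : ℕ) : ℕ :=
  (Finset.univ.filter fun S : Finset Y => S.card ≤ D).card

/-- Fourier inversion, as a reproducing kernel formula. -/
theorem lowDegree_reproducing {D : ℕ} {p : (Y → ℤˣ) → ℂ} (hp : p ∈ lowDegree Y D)
    (g : Y → ℤˣ) :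
    ∑ g', (∑ S with S.card ≤ D, character S g * character S g') * p g' =
      2 ^ Fintype.card Y * p g := by
  induction hp using Submodule.span_induction with
  | mem p hp =>
    obtain ⟨T, hT, rfl⟩ := hp
    simp only [Finset.sum_mul]
    rw [Finset.sum_comm]
    have h : ∀ S : Finset Y, ∑ g', character S g * character S g' * character T g' =
        if S = T then 2 ^ Fintype.card Y * character T g else 0 := by
      intro S
      have h1 : ∀ g', character S g * character S g' * character T g' =
          character S g * character (symmDiff S T) g' := by
        intro g'
        rw [← character_mul, Pi.mul_apply, mul_assoc]
      simp only [h1, ← Finset.mul_sum, sum_character, ← Finset.bot_eq_empty, symmDiff_eq_bot]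
      split_ifs with hST
      · rw [hST, mul_comm]
      · simp
    simp only [h, Finset.sum_ite_eq', Finset.mem_filter, Finset.mem_univ, true_and]
    exact if_pos hT
  | zero => simp
  | add p q _ _ hp hq => simp only [Pi.add_apply, mul_add, Finset.sum_add_distrib, hp, hq]
  | smul c p _ hp =>
    simp only [Pi.smul_apply, smul_eq_mul, mul_left_comm _ c, ← Finset.mul_sum, hp]

/-- A nonnegative polynomial of degree at most `D` exceeds its mean at most by the number of
monomials of degree at most `D`. -/
theorem le_mean_of_mem_lowDegree {D : ℕ} {p : (Y → ℤˣ) → ℝ} (hp0 : ∀ g, 0 ≤ p g)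
    (hp : (fun g => (p g : ℂ)) ∈ lowDegree Y D) (g : Y → ℤˣ) :
    2 ^ Fintype.card Y * p g ≤ monomialCount Y D * ∑ g', p g' := by
  have h := congrArg norm (lowDegree_reproducing hp g)
  have hr : ‖(2 : ℂ) ^ Fintype.card Y * (p g : ℂ)‖ = 2 ^ Fintype.card Y * p g := by
    simp [abs_of_nonneg (hp0 g)]
  rw [hr] at h
  rw [← h, Finset.mul_sum]
  -- Characters are unimodular, so each kernel entry has norm at most the number of monomials.
  refine (norm_sum_le _ _).trans (Finset.sum_le_sum fun g' _ => ?_)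
  rw [norm_mul, Complex.norm_real, Real.norm_of_nonneg (hp0 g')]
  refine mul_le_mul_of_nonneg_right ((norm_sum_le _ _).trans ?_) (hp0 g')
  simp [norm_character, monomialCount]

/-- Exponential weighting: a factor that is at least 1 on small sets is summed over all sets, where
the binomial theorem evaluates it. -/
theorem monomialCount_le {D : ℕ} (hD : 50 * D ≤ Fintype.card Y) :
    (monomialCount Y D : ℝ) ≤ (11 / 10 * (50 / 49)) ^ Fintype.card Y := by
  set N := Fintype.card Y
  have h1 : ∀ S : Finset Y, S.card ≤ D →
      (1 : ℝ) ≤ (11 / 10) ^ N * ((10 / 11) ^ 50) ^ S.card := by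
    intro S hS
    have : (1 : ℝ) = (11 / 10) ^ (50 * S.card) * ((10 / 11) ^ 50) ^ S.card := by
      rw [← pow_mul, ← mul_pow]
      norm_num
    rw [this]
    gcongr
    · norm_num
    · omega
  have h2 : ∑ S : Finset Y, ((10 / 11 : ℝ) ^ 50) ^ S.card = (1 + (10 / 11) ^ 50) ^ N := by
    have := Finset.prod_add (fun _ : Y => (10 / 11 : ℝ) ^ 50) (fun _ => 1) Finset.univ
    simp only [Finset.prod_const, one_pow, mul_one, Finset.powerset_univ, Finset.card_univ] at this
    rw [← this, add_comm]
  calc (monomialCount Y D : ℝ)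
      = ∑ S : Finset Y with S.card ≤ D, (1 : ℝ) := by simp [monomialCount]
    _ ≤ ∑ S : Finset Y with S.card ≤ D, (11 / 10 : ℝ) ^ N * ((10 / 11) ^ 50) ^ S.card :=
        Finset.sum_le_sum fun S hS => h1 S (Finset.mem_filter.mp hS).2
    _ ≤ ∑ S : Finset Y, (11 / 10 : ℝ) ^ N * ((10 / 11) ^ 50) ^ S.card :=
        Finset.sum_le_sum_of_subset_of_nonneg (Finset.filter_subset _ _)
          fun _ _ _ => by positivity
    _ = (11 / 10 * (1 + (10 / 11) ^ 50)) ^ N := by rw [← Finset.mul_sum, h2, mul_pow]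
    _ ≤ (11 / 10 * (50 / 49)) ^ N := by
        gcongr
        norm_num

/-- Chernoff bound for the sum of weights of a uniformly random choice of signs. -/
theorem card_light_le (d : Y → ℤˣ → ℝ) (hd0 : ∀ y b, 0 ≤ d y b)
    (hd : ∀ y, d y 1 + d y (-1) = 1) :
    ((Finset.univ.filter fun g : Y → ℤˣ => 10 * ∑ y, d y (g y) ≤ Fintype.card Y).card : ℝ) ≤
      (5 / 4 * (10 / 9)) ^ Fintype.card Y := by
  set N := Fintype.card Y
  -- This makes `t ^ s = (4/5) ^ (10 * s)`, at least `(4/5) ^ N` on light choices, while `t ≤ 1/9`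
  -- keeps each factor of the product at most `10/9`.
  set t : ℝ := (4 / 5) ^ 10 with ht
  have htpos : 0 < t := by positivity
  have h1 : ∀ g : Y → ℤˣ, 10 * ∑ y, d y (g y) ≤ N →
      (1 : ℝ) ≤ (5 / 4) ^ N * ∏ y, t ^ d y (g y) := by
    intro g hg
    rw [← Real.rpow_sum_of_pos htpos, ht, ← Real.rpow_natCast, ← Real.rpow_natCast,
      ← Real.rpow_mul (by norm_num)]
    have h2 : (4 / 5 : ℝ) ^ (N : ℝ) ≤ (4 / 5 : ℝ) ^ (((10 : ℕ) : ℝ) * ∑ y, d y (g y)) :=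
      Real.rpow_le_rpow_of_exponent_ge (by norm_num) (by norm_num) (by exact_mod_cast hg)
    have h3 : (1 : ℝ) = (5 / 4) ^ (N : ℝ) * (4 / 5) ^ (N : ℝ) := by
      rw [← Real.mul_rpow (by norm_num) (by norm_num)]
      norm_num
    calc (1 : ℝ) = (5 / 4) ^ (N : ℝ) * (4 / 5) ^ (N : ℝ) := h3
      _ ≤ _ := by gcongr
  have h2 : ∀ y, ∑ b : ℤˣ, t ^ d y b ≤ 10 / 9 := by
    intro y
    -- Bernoulli's inequality for exponents in `[0, 1]`; the weights may be fractional.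
    have hb : ∀ b, t ^ d y b ≤ 1 + d y b * (t - 1) := by
      intro b
      have hle : d y b ≤ 1 := by
        have := hd y
        have h0 := hd0 y 1
        have h1 := hd0 y (-1)
        rcases Int.units_eq_one_or b with rfl | rfl <;> linarith
      have := rpow_one_add_le_one_add_mul_self (s := t - 1) (p := d y b) (by linarith)
        (hd0 y b) hle
      simpa using this
    have hsum : ∑ b : ℤˣ, t ^ d y b = t ^ d y 1 + t ^ d y (-1) := by
      rw [show (Finset.univ : Finset ℤˣ) = {1, -1} from rfl, Finset.sum_pair (by decide)]
    have ht9 : t ≤ 1 / 9 := by rw [ht]; norm_num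
    calc ∑ b : ℤˣ, t ^ d y b = t ^ d y 1 + t ^ d y (-1) := hsum
      _ ≤ (1 + d y 1 * (t - 1)) + (1 + d y (-1) * (t - 1)) := add_le_add (hb 1) (hb (-1))
      _ = 2 + (d y 1 + d y (-1)) * (t - 1) := by ring
      _ ≤ 10 / 9 := by rw [hd y]; linarith
  calc ((Finset.univ.filter fun g : Y → ℤˣ => 10 * ∑ y, d y (g y) ≤ N).card : ℝ)
      = ∑ g : Y → ℤˣ with 10 * ∑ y, d y (g y) ≤ N, (1 : ℝ) := by simp
    _ ≤ ∑ g : Y → ℤˣ with 10 * ∑ y, d y (g y) ≤ N, (5 / 4 : ℝ) ^ N * ∏ y, t ^ d y (g y) :=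
        Finset.sum_le_sum fun g hg => h1 g (Finset.mem_filter.mp hg).2
    _ ≤ ∑ g : Y → ℤˣ, (5 / 4 : ℝ) ^ N * ∏ y, t ^ d y (g y) :=
        Finset.sum_le_sum_of_subset_of_nonneg (Finset.filter_subset _ _)
          fun _ _ _ => by positivity
    _ = (5 / 4 : ℝ) ^ N * ∏ y, ∑ b : ℤˣ, t ^ d y b := by
        rw [← Finset.mul_sum, Fintype.prod_sum (fun y (b : ℤˣ) => t ^ d y b)]
    _ ≤ (5 / 4 : ℝ) ^ N * ∏ _y : Y, (10 / 9) := by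
        gcongr with y _
        exact h2 y
    _ = (5 / 4 * (10 / 9)) ^ N := by
        rw [Finset.prod_const, Finset.card_univ, mul_pow]

/-- At most half of all choices of signs are light, since `g` and `-g` are never both light. -/
theorem two_mul_card_light_le [Nonempty Y] (d : Y → ℤˣ → ℝ) (hd : ∀ y, d y 1 + d y (-1) = 1) :
    2 * (Finset.univ.filter fun g : Y → ℤˣ => 10 * ∑ y, d y (g y) ≤ Fintype.card Y).card ≤
      2 ^ Fintype.card Y := by
  set L := Finset.univ.filter fun g : Y → ℤˣ => 10 * ∑ y, d y (g y) ≤ Fintype.card Y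
  have hdisj : Disjoint L (L.map (Equiv.neg (Y → ℤˣ)).toEmbedding) := by
    rw [Finset.disjoint_left]
    intro g hg hg'
    obtain ⟨g', hL', rfl⟩ := Finset.mem_map.mp hg'
    have h1 := (Finset.mem_filter.mp hg).2
    have h2 := (Finset.mem_filter.mp hL').2
    have h3 : ∑ y, d y (g' y) + ∑ y, d y (-g' y) = Fintype.card Y := by
      rw [← Finset.sum_add_distrib]
      have : ∀ y, d y (g' y) + d y (-g' y) = 1 := by
        intro y
        rcases Int.units_eq_one_or (g' y) with h | h <;> rw [h]
        · exact hd y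
        · rw [neg_neg, add_comm]; exact hd y
      simp [this]
    have h4 : (0 : ℝ) < Fintype.card Y := by exact_mod_cast Fintype.card_pos
    simp only [Equiv.coe_toEmbedding, Equiv.neg_apply, Pi.neg_apply] at h1
    linarith
  have h := Finset.card_le_univ (L.disjUnion _ hdisj)
  rw [Finset.card_disjUnion, Finset.card_map] at h
  simpa [two_mul] using h

end LowDegree

/-! ### Output probabilities as low-degree polynomials. -/

section Programs

variable {n d : ℕ}

theorem normSq_nonneg (ψ : StateVec n d) : 0 ≤ normSq ψ :=
  Finset.sum_nonneg fun _ _ => by positivity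

theorem ofReal_normSq (ψ : StateVec n d) : (normSq ψ : ℂ) = star ψ ⬝ᵥ ψ := by
  simp [normSq, dotProduct, Complex.conj_mul']

theorem normSq_qmqOracle (f : BoolFn n) (ψ : StateVec n d) :
    normSq (qmqOracle f ψ) = normSq ψ := by
  simp only [normSq, qmqOracle, Fintype.sum_prod_type]
  refine Finset.sum_congr rfl fun x _ => ?_
  exact Equiv.sum_comp (Equiv.mulRight (f x)) fun b => ∑ w, ‖ψ (x, b, w)‖ ^ 2

/-- Completeness of the Kraus operators conserves total probability. -/
theorem sum_normSq_mulVec {m : ℕ} (K : Fin m → Matrix (BasisLabel n d) (BasisLabel n d) ℂ)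
    (hK : ∑ i, (K i)ᴴ * K i = 1) (ψ : StateVec n d) :
    ∑ i, normSq (K i *ᵥ ψ) = normSq ψ := by
  have h : ((∑ i, normSq (K i *ᵥ ψ) : ℝ) : ℂ) = (normSq ψ : ℂ) := by
    push_cast
    simp only [ofReal_normSq, Matrix.star_mulVec, ← Matrix.dotProduct_mulVec,
      Matrix.mulVec_mulVec]
    rw [← dotProduct_sum, ← Matrix.sum_mulVec, hK, Matrix.one_mulVec]
  exact_mod_cast h

namespace Program

theorem outputProb_nonneg (f h : BoolFn n) (P : Program n d) (ψ : StateVec n d) :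
    0 ≤ P.outputProb f h ψ := by
  induction P generalizing ψ with
  | halt h' =>
    rw [outputProb]
    split_ifs
    exacts [normSq_nonneg ψ, le_rfl]
  | instr m K hK next ih => exact Finset.sum_nonneg fun i _ => ih i _
  | qmq next ih => exact ih _
  | mq x next ih => exact ih _ _

theorem sum_outputProb (f : BoolFn n) (P : Program n d) (ψ : StateVec n d) :
    ∑ h, P.outputProb f h ψ = normSq ψ := by
  induction P generalizing ψ with
  | halt h' => simp [outputProb]
  | instr m K hK next ih =>
    simp only [outputProb]
    rw [Finset.sum_comm]
    simp only [ih]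
    exact sum_normSq_mulVec K hK ψ
  | qmq next ih => simp only [outputProb, ih, normSq_qmqOracle]
  | mq x next ih => simp only [outputProb, ih]

/-- The output probabilities are polynomials in the values of the target function. -/
theorem outputProb_mem_lowDegree {Y : Type*} [Fintype Y] [DecidableEq Y] (π : Cube n → Y)
    (h : BoolFn n) (P : Program n d) {a : ℕ} (ψ : (Y → ℤˣ) → StateVec n d)
    (hψ : ∀ z, (fun g => ψ g z) ∈ lowDegree Y a) :
    (fun g => (P.outputProb (g ∘ π) h (ψ g) : ℂ)) ∈
      lowDegree Y (2 * a + 2 * P.qmqCount + P.mqCount) := by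
  induction P generalizing a ψ with
  | halt h' =>
    simp only [outputProb]
    split_ifs
    · have e : (fun g => ((normSq (ψ g) : ℝ) : ℂ)) =
          ∑ z, star (fun g => ψ g z) * fun g => ψ g z := by
        funext g
        simp [ofReal_normSq, dotProduct]
      rw [e]
      refine Submodule.sum_mem _ fun z _ => ?_
      -- The Born rule multiplies an amplitude by its conjugate, doubling the degree `a`.
      exact lowDegree_mono (by simp [qmqCount, mqCount]; omega)
        (mul_mem_lowDegree (star_mem_lowDegree (hψ z)) (hψ z))
    · exact const_mem_lowDegree _ _
  | instr m K hK next ih =>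
    have e : (fun g => (((instr m K hK next).outputProb (g ∘ π) h (ψ g) : ℝ) : ℂ)) =
        ∑ i, fun g => ((next i).outputProb (g ∘ π) h (K i *ᵥ ψ g) : ℂ) := by
      funext g
      simp [outputProb]
    rw [e]
    refine Submodule.sum_mem _ fun i _ => ?_
    have hq : (next i).qmqCount ≤ (instr m K hK next).qmqCount :=
      Finset.le_sup (f := fun i => (next i).qmqCount) (Finset.mem_univ i)
    have hm : (next i).mqCount ≤ (instr m K hK next).mqCount :=
      Finset.le_sup (f := fun i => (next i).mqCount) (Finset.mem_univ i)
    refine lowDegree_mono (by omega) (ih i (a := a) (fun g => K i *ᵥ ψ g) fun z => ?_)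
    have e : (fun g => (K i *ᵥ ψ g) z) = ∑ z', K i z z' • fun g => ψ g z' := by
      funext g
      simp [Matrix.mulVec, dotProduct]
    rw [e]
    exact Submodule.sum_mem _ fun z' _ => Submodule.smul_mem _ _ (hψ z')
  | qmq next ih =>
    refine lowDegree_mono (by simp only [qmqCount, mqCount]; omega)
      (ih (a := a + 1) (fun g => qmqOracle (g ∘ π) (ψ g)) fun z => ?_)
    exact select_mem_lowDegree (π z.1) (p := fun b g => ψ g (z.1, z.2.1 * b, z.2.2))
      fun b => hψ _
  | mq x next ih =>
    -- The state is untouched, so the selection acts on the final probability and its cost is not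
    -- doubled.
    have hs := select_mem_lowDegree (π x) (D := 2 * a + 2 * (mq x next).qmqCount +
        Finset.univ.sup fun b => (next b).mqCount)
      (p := fun b g => ((next b).outputProb (g ∘ π) h (ψ g) : ℂ)) fun b => by
        have hq : (next b).qmqCount ≤ (mq x next).qmqCount :=
          Finset.le_sup (f := fun b => (next b).qmqCount) (Finset.mem_univ b)
        have hm : (next b).mqCount ≤ Finset.univ.sup fun b => (next b).mqCount :=
          Finset.le_sup (f := fun b => (next b).mqCount) (Finset.mem_univ b)
        exact lowDegree_mono (by omega) (ih b ψ hψ)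
    exact lowDegree_mono (by simp only [mqCount]; omega) hs

end Program

end Programs

/-! ### Averaging over targets that depend on the first `k` variables. -/

section Counting

variable {k m : ℕ}

/-- The function of `k + m` variables which applies `g` to the first `k` of them. -/
def extend (m : ℕ) (g : Cube k → ℤˣ) : BoolFn (k + m) :=
  g ∘ fun x i => x (Fin.castAdd m i)

theorem isJunta_extend (g : Cube k → ℤˣ) : IsJunta k (extend m g) := by
  refine ⟨Finset.univ.map (Fin.castAddEmb m), by simp, fun x y hxy => ?_⟩
  refine congrArg g (funext fun i => hxy _ ?_)
  simp

/-- The fraction of the extensions of `y` on which `h` differs from `b`. -/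
noncomputable def errorWeight (h : BoolFn (k + m)) (y : Cube k) (b : ℤˣ) : ℝ :=
  (∑ z : Cube m, if h (Fin.append y z) = b then 0 else 1) / 2 ^ m

theorem errorWeight_nonneg (h : BoolFn (k + m)) (y : Cube k) (b : ℤˣ) :
    0 ≤ errorWeight h y b :=
  div_nonneg (Finset.sum_nonneg fun _ _ => by split_ifs <;> norm_num) (by positivity)

theorem errorWeight_add (h : BoolFn (k + m)) (y : Cube k) :
    errorWeight h y 1 + errorWeight h y (-1) = 1 := by
  rw [errorWeight, errorWeight, ← add_div, ← Finset.sum_add_distrib]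
  have : ∀ z : Cube m, ((if h (Fin.append y z) = 1 then (0 : ℝ) else 1) +
      if h (Fin.append y z) = -1 then 0 else 1) = 1 := by
    intro z
    rcases Int.units_eq_one_or (h (Fin.append y z)) with e | e <;> rw [e]
    · rw [if_pos rfl, if_neg (by decide)]; norm_num
    · rw [if_neg (by decide), if_pos rfl]; norm_num
  simp [this]

theorem card_cube (k : ℕ) : Fintype.card (Cube k) = 2 ^ k := by simp

theorem card_agree_extend (g : Cube k → ℤˣ) (h : BoolFn (k + m)) :
    ((Finset.univ.filter fun x => h x = extend m g x).card : ℝ) =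
      2 ^ m * (2 ^ k - ∑ y, errorWeight h y (g y)) := by
  have h1 : ((Finset.univ.filter fun x => h x = extend m g x).card : ℝ) =
      ∑ y : Cube k, ∑ z : Cube m, if h (Fin.append y z) = g y then 1 else 0 := by
    rw [← Finset.sum_boole, ← (Fin.appendEquiv k m).sum_comp, Fintype.sum_prod_type]
    simp [Fin.appendEquiv, extend]
  have h2 : ∀ y, (∑ z : Cube m, if h (Fin.append y z) = g y then (1 : ℝ) else 0) =
      2 ^ m * (1 - errorWeight h y (g y)) := by
    intro y
    rw [errorWeight, mul_sub, mul_div_cancel₀ _ (by positivity), eq_sub_iff_add_eq,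
      ← Finset.sum_add_distrib]
    have : ∀ z : Cube m, ((if h (Fin.append y z) = g y then (1 : ℝ) else 0) +
        if h (Fin.append y z) = g y then 0 else 1) = 1 := by
      intro z
      split_ifs <;> norm_num
    simp [this]
  rw [h1]
  simp only [h2, ← Finset.mul_sum, Finset.sum_sub_distrib]
  simp

theorem isAccurate_extend_iff (g : Cube k → ℤˣ) (h : BoolFn (k + m)) :
    IsAccurate (1 / 10) (extend m g) h ↔
      10 * ∑ y, errorWeight h y (g y) ≤ Fintype.card (Cube k) := by
  rw [IsAccurate, card_agree_extend, pow_add, mul_comm ((2 : ℝ) ^ k),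
    mul_div_mul_left _ _ (by positivity), le_div_iff₀ (by positivity), card_cube]
  push_cast
  constructor <;> intro h <;> linarith

/-- Averaging over all targets which depend on the first `k` variables only: the success
probability of a learner is bounded by the number of targets that one hypothesis approximates,
times the number of monomials of bounded degree. -/
theorem success_le_mul (A : Algorithm (k + m))
    (hA : A.IsLearner (1 / 10) {f | IsJunta k f}) {B : ℝ}
    (hB : ∀ h : BoolFn (k + m), ((Finset.univ.filter fun g : Cube k → ℤˣ =>
      10 * ∑ y, errorWeight h y (g y) ≤ Fintype.card (Cube k)).card : ℝ) ≤ B) :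
    2 / 3 * 2 ^ 2 ^ k ≤ B * monomialCount (Cube k) (2 * A.qmqCount + A.mqCount) := by
  classical
  have hB' : ∀ h : BoolFn (k + m), ((Finset.univ.filter fun g : Cube k → ℤˣ =>
      IsAccurate (1 / 10) (extend m g) h).card : ℝ) ≤ B := by
    intro h
    refine le_trans (le_of_eq ?_) (hB h)
    congr 2
    ext g
    simp only [Finset.mem_filter, isAccurate_extend_iff]
  set C : ℝ := (monomialCount (Cube k) (2 * A.qmqCount + A.mqCount) : ℝ)
  set p : BoolFn (k + m) → (Cube k → ℤˣ) → ℝ := fun h g => A.outputProb (extend m g) h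
  have hp0 : ∀ h g, 0 ≤ p h g := fun h g => Program.outputProb_nonneg _ _ _ _
  have hsum : ∀ g, ∑ h, p h g = 1 := fun g =>
    (Program.sum_outputProb _ _ _).trans A.init_unit
  have hpt : ∀ h g, 2 ^ 2 ^ k * p h g ≤ C * ∑ g', p h g' := by
    intro h g
    -- Degree 0 at the start: the initial state does not depend on the target.
    have hdeg := Program.outputProb_mem_lowDegree (a := 0)
      (fun (x : Cube (k + m)) (i : Fin k) => x (Fin.castAdd m i)) h A.program
      (fun _ => A.init) fun z => const_mem_lowDegree _ _
    have := le_mean_of_mem_lowDegree (D := 2 * A.qmqCount + A.mqCount) (hp0 h)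
      (lowDegree_mono (by simp [Algorithm.qmqCount, Algorithm.mqCount]) hdeg) g
    rw [card_cube] at this
    exact this
  have hN : (0 : ℝ) < 2 ^ 2 ^ k := by positivity
  have hcardG : (Fintype.card (Cube k → ℤˣ) : ℝ) = 2 ^ 2 ^ k := by simp
  have h1 : 2 / 3 * 2 ^ 2 ^ k ≤
      ∑ h, ∑ g with IsAccurate (1 / 10) (extend m g) h, p h g := by
    have : ∑ h, ∑ g with IsAccurate (1 / 10) (extend m g) h, p h g =
        ∑ g, ∑ h with IsAccurate (1 / 10) (extend m g) h, p h g := by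
      simp only [Finset.sum_filter]
      exact Finset.sum_comm
    rw [this]
    calc (2 / 3 * 2 ^ 2 ^ k : ℝ) = ∑ _g : Cube k → ℤˣ, (2 / 3 : ℝ) := by
          rw [Finset.sum_const, Finset.card_univ, nsmul_eq_mul, hcardG, mul_comm]
      _ ≤ _ := Finset.sum_le_sum fun g _ => hA _ (isJunta_extend g)
  have h2 : ∀ h, ∑ g with IsAccurate (1 / 10) (extend m g) h, p h g ≤
      B * (C / 2 ^ 2 ^ k * ∑ g', p h g') := by
    intro h
    have hS : 0 ≤ C / 2 ^ 2 ^ k * ∑ g', p h g' :=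
      mul_nonneg (by positivity) (Finset.sum_nonneg fun g _ => hp0 h g)
    calc _ ≤ ∑ g with IsAccurate (1 / 10) (extend m g) h, C / 2 ^ 2 ^ k * ∑ g', p h g' := by
          refine Finset.sum_le_sum fun g _ => ?_
          rw [div_mul_eq_mul_div, le_div_iff₀ hN, mul_comm]
          exact hpt h g
      _ ≤ _ := by
          rw [Finset.sum_const, nsmul_eq_mul]
          exact mul_le_mul_of_nonneg_right (hB' h) hS
  refine h1.trans ((Finset.sum_le_sum fun h _ => h2 h).trans_eq ?_)
  -- After exchanging the sums, the output probabilities for each `g` add up to 1, so the number of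
  -- hypotheses never enters.
  rw [← Finset.mul_sum, ← Finset.mul_sum, Finset.sum_comm]
  simp only [hsum]
  rw [Finset.sum_const, Finset.card_univ, nsmul_eq_mul, hcardG]
  field_simp

end Counting

end JuntaLearning

/-! ### The choice of constants and the contradiction. -/

theorem mainTheorem4 :
    ∃ c : ℝ, 0 < c ∧ ∀ (k n : ℕ), k ≤ n → ∀ A : JuntaLearning.Algorithm n,
      A.IsLearner (1 / 10) {f | JuntaLearning.IsJunta k f} →
      (A.mqCount : ℝ) ≤ 1 / 101 * 2 ^ k →
      c * 2 ^ k ≤ (A.qmqCount : ℝ) := by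
  open JuntaLearning in
  -- With this constant `D / N` is below `2/200 + 1/101 < 1/50`, as `monomialCount_le` requires.
  refine ⟨1 / 200, by norm_num, fun k n hkn A hA hmq => ?_⟩
  obtain ⟨m, rfl⟩ := Nat.exists_eq_add_of_le hkn
  by_contra! hq
  have hD : 50 * (2 * A.qmqCount + A.mqCount) ≤ Fintype.card (Cube k) := by
    rw [card_cube]
    have h : (50 * (2 * A.qmqCount + A.mqCount) : ℝ) ≤ 2 ^ k := by
      have : (0 : ℝ) < 2 ^ k := by positivity
      linarith
    exact_mod_cast h
  have hC := monomialCount_le hD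
  -- For `k = 0` the Chernoff bound is too weak; pairing `g` with `-g` gives `B = 1`, and `4/3 ≤
  -- 55/49` fails.
  rcases Nat.eq_zero_or_pos k with rfl | hk
  · have h := success_le_mul A hA (B := 1) fun h => by
      have h2 := two_mul_card_light_le (errorWeight h) (errorWeight_add h)
      rw [card_cube 0, pow_zero, pow_one] at h2
      rw [card_cube 0, pow_zero]
      rw [Nat.cast_le_one]
      omega
    rw [card_cube] at hC
    norm_num at h hC
    linarith
  · have h := success_le_mul A hA (B := (5 / 4 * (10 / 9)) ^ 2 ^ k) fun h => by
      have h2 := card_light_le (errorWeight h) (errorWeight_nonneg h) (errorWeight_add h)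
      rw [card_cube] at h2 ⊢
      exact h2
    rw [card_cube] at hC
    have h3 : (2 / 3 * 2 ^ 2 ^ k : ℝ) ≤
        (5 / 4 * (10 / 9)) ^ 2 ^ k * (11 / 10 * (50 / 49)) ^ 2 ^ k :=
      h.trans (mul_le_mul_of_nonneg_left hC (by positivity))
    rw [← mul_pow, ← le_div_iff₀ (by positivity), ← div_pow] at h3
    -- The ratio is about 0.78, above `2/3`, but its square is about 0.61; hence `2 ^ k ≥ 2` is
    -- needed.
    have h4 : (5 / 4 * (10 / 9) * (11 / 10 * (50 / 49)) / 2 : ℝ) ^ 2 ^ k ≤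
        (5 / 4 * (10 / 9) * (11 / 10 * (50 / 49)) / 2) ^ 2 := by
      refine pow_le_pow_of_le_one (by norm_num) (by norm_num) ?_
      calc 2 = 2 ^ 1 := rfl
        _ ≤ 2 ^ k := Nat.pow_le_pow_right (by norm_num) hk
    have h5 := h3.trans h4
    norm_num at h5
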